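/- Let $A_1,A_2,A_3$ be the vertices of an equilateral triangle in the Euclidean plane, let $r>0$, and let $V$ be a finite set of points (nodes) in the closed triangle $A_1A_2A_3$. For a point $x$ of the triangle let $x_k$ be its distance to the side of the triangle opposite to $A_k$ ($k=1,2,3$), and assume that no two distinct nodes $x,y$ satisfy $x_k=y_k$ for some $k$. Write $x<_k y$ if $x_k<y_k$, let $\min_k$ be the minimum with respect to $<_k$, and let $A_k^x=\{z\in V: x<_k z \text{ and } z<_j x \text{ for all } j\neq k\}$. Let $G$ be the unit disk graph on $V$: two distinct nodes are adjacent if and only if their distance is at most $r$. Define the graph $\widetilde G'$ on $V$ as follows. For every node $x$ and every $k\in\{1,2,3\}$ such that $x$ has a $G$-neighbour in $A_k^x$, start with $y=\min_k\{z\in A_k^x : z \text{ is a } G\text{-neighbour of } x\}$. As long as the set of all $z\in A_k^x$ with $z<_k y$, $z$ adjacent to $y$ in $G$, and $|xz|>r$ is non-empty, replace $y$ by the $\min_k$ of this set. When the set is empty, join $x$ to the final node $y$ by an (undirected) edge of $\widetilde G'$; the edge is called virtual if it is not an edge of $G$. These are all the edges of $\widetilde G'$. If $G$ is connected, then $\widetilde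 G'$ is planar; more precisely, drawing each edge of $\widetilde G'$ as the straight segment between its end points gives a plane drawing without crossings. Moreover, for any two nodes $x$ and $y$, if there is a path from $x$ to $y$ in $G$ of Euclidean length $\ell$ (the sum of the Euclidean lengths of its edges), then there is a path from $x$ to $y$ in $\widetilde G'$ of Euclidean length at most $2\ell$. -/

import Mathlib

/-- The Euclidean plane. -/
abbrev Plane : Type := EuclideanSpace ℝ (Fin 2)

/-! ### Planar graphs -/

/-- `C` is a simple arc in the plane with end points `a` and `b`. -/
def IsSimpleArc (a b : Plane) (C : Set Plane) : Prop :=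
  ∃ γ : Path a b, Function.Injective γ ∧ Set.range γ = C

/-- The points `pos v` and the sets `arc e` form a drawing of `G` in the plane without crossings:
distinct vertices are distinct points, each edge is a simple arc joining its end points, an edge
passes through no vertex other than its end points, and two distinct edges meet at most in
end points that they share. -/
structure IsPlaneEmbedding {V : Type*} (G : SimpleGraph V) (pos : V → Plane)
    (arc : Sym2 V → Set Plane) : Prop where
  pos_injective : Function.Injective pos
  isSimpleArc : ∀ u v, G.Adj u v → IsSimpleArc (pos u) (pos v) (arc s(u, v))
  mem_of_pos_mem : ∀ e ∈ G.edgeSet, ∀ w, pos w ∈ arc e → w ∈ e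
  inter_subset : ∀ e ∈ G.edgeSet, ∀ f ∈ G.edgeSet, e ≠ f →
    arc e ∩ arc f ⊆ pos '' {w | w ∈ e ∧ w ∈ f}

/-- A graph is planar if it can be drawn in the plane without crossings. -/
def IsPlanar {V : Type*} (G : SimpleGraph V) : Prop :=
  ∃ (pos : V → Plane) (arc : Sym2 V → Set Plane), IsPlaneEmbedding G pos arc

/-- The closed straight segment joining the positions of the two end points of an edge. -/
def straightEdge {V : Type*} (pos : V → Plane) : Sym2 V → Set Plane :=
  Sym2.lift ⟨fun u v => segment ℝ (pos u) (pos v), fun _ _ => segment_symm ℝ _ _⟩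

/-! ### Unit disk graphs and Euclidean length -/

/-- The unit disk graph with communication radius `r` on nodes placed at `pos`: two distinct nodes
are adjacent when their distance is at most `r`. -/
def unitDiskGraph {V : Type*} (r : ℝ) (pos : V → Plane) : SimpleGraph V where
  Adj u v := u ≠ v ∧ dist (pos u) (pos v) ≤ r
  symm := ⟨fun _ _ h => ⟨h.1.symm, by rw [dist_comm]; exact h.2⟩⟩
  loopless := ⟨fun _ h => h.1 rfl⟩

/-- The Euclidean length of a walk: the sum of the lengths of its edges. -/
noncomputable def euclideanLength {V : Type*} {G : SimpleGraph V} (pos : V → Plane) {x y : V}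
    (p : G.Walk x y) : ℝ :=
  (p.darts.map fun d => dist (pos d.fst) (pos d.snd)).sum

/-! ### Height coordinates and the graph with virtual edges -/

/-- The `k`-th height coordinate of the point `x` with respect to the anchors: the height over the
side `A_{k+1} A_{k+2}` (indices mod 3) of the triangle that `x` forms with this side, that is,
the distance from `x` to the line through the two anchors other than `A_k`. -/
noncomputable def heightCoord (A : Affine.Triangle ℝ Plane) (k : Fin 3) (x : Plane) : ℝ :=
  Metric.infDist x (line[ℝ, A.points (k + 1), A.points (k + 2)] : Set Plane)

section VirtualGraph

variable {V : Type*} (A : Affine.Triangle ℝ Plane) (r : ℝ) (pos : V → Plane)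

/-- The order `x <_k y`. -/
def ltCoord (k : Fin 3) (x y : V) : Prop :=
  heightCoord A k (pos x) < heightCoord A k (pos y)

/-- The `k`-th greedy region of `x`: the nodes `z` with `x <_k z` and `z <_j x` for `j ≠ k`. -/
def greedyRegion (k : Fin 3) (x : V) : Set V :=
  {z | ltCoord A pos k x z ∧ ∀ j, j ≠ k → ltCoord A pos j z x}

/-- `y = min_k S`: the node `y` belongs to `S` and no node of `S` is smaller for `<_k`. -/
def IsMinCoord (k : Fin 3) (S : Set V) (y : V) : Prop :=
  y ∈ S ∧ ∀ z ∈ S, ¬ ltCoord A pos k z y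

/-- The nodes by which the current candidate `y` in the `k`-th greedy region of `x` has to be
replaced: the nodes of this region that are neighbours of `y`, precede `y` for `<_k`, and are
out of the communication range of `x`. -/
def betterCandidates (k : Fin 3) (x y : V) : Set V :=
  {z | z ∈ greedyRegion A pos k x ∧ ltCoord A pos k z y ∧
    (unitDiskGraph r pos).Adj y z ∧ r < dist (pos x) (pos z)}

/-- `z` is the node to which `x` is linked in its `k`-th greedy region. One starts from the
`<_k`-minimal neighbour `y` of `x` in this region; as long as there are better candidates, the
current candidate is replaced by the `<_k`-minimal one among them; `z` is the last candidate.
If `z ≠ y`, the link from `x` to `z` is virtual and replaces the edge from `x` to `y`. -/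
def IsLink (k : Fin 3) (x z : V) : Prop :=
  ∃ y, IsMinCoord A pos k {w ∈ greedyRegion A pos k x | (unitDiskGraph r pos).Adj x w} y ∧
    Relation.ReflTransGen (fun u v => IsMinCoord A pos k (betterCandidates A r pos k x u) v) y z ∧
    betterCandidates A r pos k x z = ∅

/-- The graph whose edges are the links and virtual links of all nodes, regarded as undirected. -/
def virtualGraph : SimpleGraph V :=
  SimpleGraph.fromRel fun x z => ∃ k, IsLink A r pos k x z

end VirtualGraph

/-! In an equilateral triangle of side `a` the heights are the barycentric weights times `√3 / 2 *
a`. Hence their sum is constant (`heightCoord_add_add`), and distances are given by the form `p ^ 2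
+ p * q + q ^ 2` in two height differences (`dist_sq_eq`).

The key point is that a link leads to the `<_k`-lowest node of the whole greedy region, whatever `r`
is (`IsLink.isMinCoord`). The construction thus yields a subgraph of the half-theta-six graph.

Planarity: each node other than the ends of an edge exceeds both ends in some coordinate
(`exists_ltCoord_of_adj`). With only three coordinates, two disjoint edges are then separated by a
level line, and edges with a common end meet nowhere else.

Spanning: it suffices to replace one edge `xy` of the unit disk graph. Induction on the height of
the triangle spanned by `x` and `y` builds a walk bounded by a route along its sides
(`spanningBound_of_adj`). The pairs to which the induction is applied are again edges of the unit
disk graph, and comparing such a route with `dist x y` gives the factor 2. -/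

/-! ### Geometry of height coordinates -/

namespace Affine.Triangle

variable {A : Affine.Triangle ℝ Plane}

/-- The side length of a triangle known to be equilateral. -/
noncomputable def sideLength (A : Affine.Triangle ℝ Plane) : ℝ := dist (A.points 0) (A.points 1)

theorem sideLength_pos (A : Affine.Triangle ℝ Plane) : 0 < A.sideLength :=
  dist_pos.2 (A.independent.injective.ne (by decide))

theorem norm_sub_eq_sideLength (hA : A.Equilateral) {i j : Fin 3} (h : i ≠ j) :
    ‖A.points i - A.points j‖ = A.sideLength := by
  rw [← dist_eq_norm]
  exact hA.dist_eq h (by decide)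

/-- The third side determines the inner product of the two edge vectors by polarisation: it is half
the squared side length. -/
theorem norm_smul_add_smul_sq (hA : A.Equilateral) {i j k : Fin 3} (hij : i ≠ j) (hik : i ≠ k)
    (hjk : j ≠ k) (p q : ℝ) :
    ‖p • (A.points i - A.points k) + q • (A.points j - A.points k)‖ ^ 2 =
      A.sideLength ^ 2 * (p ^ 2 + p * q + q ^ 2) := by
  have h1 := norm_sub_eq_sideLength hA hik
  have h2 := norm_sub_eq_sideLength hA hjk
  have h3 := norm_sub_eq_sideLength hA hij
  have h4 := norm_sub_sq_real (A.points i - A.points k) (A.points j - A.points k)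
  rw [sub_sub_sub_cancel_right, h1, h2, h3] at h4
  rw [norm_add_sq_real, norm_smul, norm_smul, inner_smul_left, inner_smul_right, h1, h2, mul_pow,
    mul_pow, Real.norm_eq_abs, Real.norm_eq_abs, sq_abs, sq_abs]
  simp only [conj_trivial]
  linear_combination (p * q) * h4

theorem heightCoord_combination (hA : A.Equilateral) (k : Fin 3) {x y z : ℝ} (hx : 0 ≤ x)
    (hsum : x + y + z = 1) :
    heightCoord A k (x • A.points k + y • A.points (k + 1) + z • A.points (k + 2)) =
      √3 / 2 * A.sideLength * x := by
  have h1 : k + 1 ≠ k + 2 := by fin_cases k <;> decide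
  have h2 : k ≠ k + 1 := by fin_cases k <;> decide
  have h3 : k ≠ k + 2 := by fin_cases k <;> decide
  have hs : √3 ^ 2 = 3 := Real.sq_sqrt (by norm_num)
  have ha := A.sideLength_pos
  have key : ∀ t : ℝ,
      dist (x • A.points k + y • A.points (k + 1) + z • A.points (k + 2))
        (AffineMap.lineMap (A.points (k + 1)) (A.points (k + 2)) t) ^ 2 =
      A.sideLength ^ 2 * (x ^ 2 + x * (y - (1 - t)) + (y - (1 - t)) ^ 2) := by
    intro t
    rw [dist_eq_norm, ← norm_smul_add_smul_sq hA h2 h3 h1]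
    congr 2
    obtain rfl : z = 1 - x - y := by linarith
    rw [AffineMap.lineMap_apply_module]
    module
  have hnn : 0 ≤ √3 / 2 * A.sideLength * x := by positivity
  refine le_antisymm ?_ ?_
  -- The foot of the perpendicular: the quadratic in `key` is minimal at `y - (1 - t) = -x / 2`.
  · refine (Metric.infDist_le_dist_of_mem
      (AffineMap.lineMap_mem_affineSpan_pair (1 - (y + x / 2)) _ _)).trans ?_
    refine abs_le_of_sq_le_sq' ?_ hnn |>.2
    rw [key]
    nlinarith
  · refine (Metric.le_infDist ⟨_, left_mem_affineSpan_pair ℝ _ _⟩).2 fun p hp => ?_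
    obtain ⟨t, rfl⟩ := mem_affineSpan_pair_iff_exists_lineMap_eq.1 hp
    refine abs_le_of_sq_le_sq' ?_ dist_nonneg |>.2
    rw [key]
    have := mul_nonneg (sq_nonneg A.sideLength) (sq_nonneg (x / 2 + (y - (1 - t))))
    nlinarith

theorem exists_weights {X : Plane} (hX : X ∈ convexHull ℝ (Set.range A.points)) :
    ∃ w : Fin 3 → ℝ, (∀ i, 0 ≤ w i) ∧ ∑ i, w i = 1 ∧ X = ∑ i, w i • A.points i := by
  rw [convexHull_range_eq_exists_affineCombination] at hX
  obtain ⟨s, w, hw0, hw1, rfl⟩ := hX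
  refine ⟨fun i => if i ∈ s then w i else 0, fun i => ?_, ?_, ?_⟩
  · dsimp only
    split_ifs with h
    exacts [hw0 i h, le_rfl]
  · simpa [Finset.sum_ite_mem] using hw1
  · rw [Finset.affineCombination_eq_linear_combination _ _ _ hw1]
    simp [ite_smul, Finset.sum_ite_mem]

theorem heightCoord_sum_smul (hA : A.Equilateral) (k : Fin 3) {w : Fin 3 → ℝ}
    (hw : ∀ i, 0 ≤ w i) (hsum : ∑ i, w i = 1) :
    heightCoord A k (∑ i, w i • A.points i) = √3 / 2 * A.sideLength * w k := by
  rw [← heightCoord_combination hA k (hw k) (y := w (k + 1)) (z := w (k + 2))]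
  · congr 1
    fin_cases k <;> simp [Fin.sum_univ_three] <;> abel
  · rw [← hsum]
    fin_cases k <;> simp [Fin.sum_univ_three] <;> ring

theorem sum_eq_of_ne {M : Type*} [AddCommMonoid M] {i j k : Fin 3} (hij : i ≠ j) (hik : i ≠ k)
    (hjk : j ≠ k) (f : Fin 3 → M) : ∑ l, f l = f i + f j + f k := by
  have : (Finset.univ : Finset (Fin 3)) = {i, j, k} := by
    revert i j k; decide
  rw [this, Finset.sum_insert (by simp [hij, hik]), Finset.sum_pair hjk, add_assoc]

theorem heightCoord_add_add (hA : A.Equilateral) {i j k : Fin 3} (hij : i ≠ j) (hik : i ≠ k)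
    (hjk : j ≠ k) {X : Plane} (hX : X ∈ convexHull ℝ (Set.range A.points)) :
    heightCoord A i X + heightCoord A j X + heightCoord A k X = √3 / 2 * A.sideLength := by
  obtain ⟨w, hw, hsum, rfl⟩ := exists_weights hX
  rw [← sum_eq_of_ne hij hik hjk fun l => heightCoord A l (∑ i, w i • A.points i)]
  simp_rw [heightCoord_sum_smul hA _ hw hsum]
  rw [← Finset.mul_sum, hsum, mul_one]

theorem dist_sq_eq (hA : A.Equilateral) {i j : Fin 3} (hij : i ≠ j) {X Y : Plane}
    (hX : X ∈ convexHull ℝ (Set.range A.points)) (hY : Y ∈ convexHull ℝ (Set.range A.points)) :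
    dist X Y ^ 2 = 4 / 3 * ((heightCoord A i X - heightCoord A i Y) ^ 2 +
      (heightCoord A i X - heightCoord A i Y) * (heightCoord A j X - heightCoord A j Y) +
      (heightCoord A j X - heightCoord A j Y) ^ 2) := by
  obtain ⟨k, hik, hjk⟩ : ∃ k, i ≠ k ∧ j ≠ k := by revert i j; decide
  obtain ⟨w, hw, hsum, rfl⟩ := exists_weights hX
  obtain ⟨v, hv, hsum', rfl⟩ := exists_weights hY
  simp_rw [heightCoord_sum_smul hA _ hw hsum, heightCoord_sum_smul hA _ hv hsum']
  have hs : √3 ^ 2 = 3 := Real.sq_sqrt (by norm_num)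
  have h : dist (∑ i, w i • A.points i) (∑ i, v i • A.points i) ^ 2 = A.sideLength ^ 2 *
      ((w i - v i) ^ 2 + (w i - v i) * (w j - v j) + (w j - v j) ^ 2) := by
    rw [dist_eq_norm, ← norm_smul_add_smul_sq hA hij hik hjk]
    congr 2
    rw [sum_eq_of_ne hij hik hjk] at hsum hsum'
    rw [sum_eq_of_ne hij hik hjk, sum_eq_of_ne hij hik hjk]
    obtain h1 : w k = 1 - w i - w j := by linarith
    obtain h2 : v k = 1 - v i - v j := by linarith
    rw [h1, h2]
    module
  rw [h]
  linear_combination (-(1 / 3) * A.sideLength ^ 2 *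
    ((w i - v i) ^ 2 + (w i - v i) * (w j - v j) + (w j - v j) ^ 2)) * hs

theorem heightCoord_convex_combination (hA : A.Equilateral) (k : Fin 3) {X Y : Plane}
    (hX : X ∈ convexHull ℝ (Set.range A.points)) (hY : Y ∈ convexHull ℝ (Set.range A.points))
    {s t : ℝ} (hs : 0 ≤ s) (ht : 0 ≤ t) (hst : s + t = 1) :
    heightCoord A k (s • X + t • Y) = s * heightCoord A k X + t * heightCoord A k Y := by
  obtain ⟨w, hw, hsum, rfl⟩ := exists_weights hX
  obtain ⟨v, hv, hsum', rfl⟩ := exists_weights hY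
  have h : s • (∑ i, w i • A.points i) + t • (∑ i, v i • A.points i) =
      ∑ i, (s * w i + t * v i) • A.points i := by
    simp [Finset.smul_sum, add_smul, mul_smul, Finset.sum_add_distrib]
  rw [h, heightCoord_sum_smul hA k hw hsum, heightCoord_sum_smul hA k hv hsum',
    heightCoord_sum_smul hA k (w := fun i => s * w i + t * v i)
      (fun i => add_nonneg (mul_nonneg hs (hw i)) (mul_nonneg ht (hv i)))]
  · ring
  · rw [Finset.sum_add_distrib, ← Finset.mul_sum, ← Finset.mul_sum, hsum, hsum']
    linarith

end Affine.Triangle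

/-! ### Links are the edges of the half-theta-six graph -/

open Affine.Triangle

section Links

variable {V : Type*} {A : Affine.Triangle ℝ Plane} {r : ℝ} {pos : V → Plane}

theorem mem_greedyRegion_iff {i j k : Fin 3} (hij : i ≠ j) (hik : i ≠ k) (hjk : j ≠ k) {x z : V} :
    z ∈ greedyRegion A pos k x ↔ ltCoord A pos k x z ∧ ltCoord A pos i z x ∧ ltCoord A pos j z x := by
  have h : ∀ l, l ≠ k → l = i ∨ l = j := by revert i j k; decide
  refine and_congr_right fun _ => ⟨fun H => ⟨H i hik, H j hjk⟩, fun H l hl => ?_⟩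
  rcases h l hl with rfl | rfl
  exacts [H.1, H.2]

theorem mem_greedyRegion_of_lt (hA : A.Equilateral)
    (hpos : ∀ v, pos v ∈ convexHull ℝ (Set.range A.points)) {i j k : Fin 3} (hij : i ≠ j)
    (hik : i ≠ k) (hjk : j ≠ k) {x z : V} (hi : ltCoord A pos i z x) (hj : ltCoord A pos j z x) :
    z ∈ greedyRegion A pos k x := by
  refine (mem_greedyRegion_iff hij hik hjk).2 ⟨?_, hi, hj⟩
  have hx := heightCoord_add_add hA hij hik hjk (hpos x)
  have hz := heightCoord_add_add hA hij hik hjk (hpos z)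
  unfold ltCoord at *
  linarith

theorem exists_ne_ne (k : Fin 3) : ∃ i j : Fin 3, i ≠ j ∧ i ≠ k ∧ j ≠ k := by
  revert k; decide

theorem ne_of_mem_greedyRegion {k : Fin 3} {x z : V} (h : z ∈ greedyRegion A pos k x) : x ≠ z := by
  rintro rfl
  exact lt_irrefl _ h.1

theorem mem_greedyRegion_or_mem_greedyRegion (hA : A.Equilateral)
    (hpos : ∀ v, pos v ∈ convexHull ℝ (Set.range A.points))
    (hgen : ∀ (k : Fin 3) (u v : V), u ≠ v → heightCoord A k (pos u) ≠ heightCoord A k (pos v))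
    {u v : V} (huv : u ≠ v) : ∃ k, v ∈ greedyRegion A pos k u ∨ u ∈ greedyRegion A pos k v := by
  have key : ∀ {i j k : Fin 3}, i ≠ j → i ≠ k → j ≠ k →
      ∀ {x z : V}, ltCoord A pos i z x → ltCoord A pos j z x → z ∈ greedyRegion A pos k x :=
    fun hij hik hjk => mem_greedyRegion_of_lt hA hpos hij hik hjk
  rcases (hgen 0 u v huv).lt_or_gt with h0 | h0 <;>
    rcases (hgen 1 u v huv).lt_or_gt with h1 | h1
  · exact ⟨2, .inr (key (by decide) (by decide) (by decide) h0 h1)⟩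
  · rcases (hgen 2 u v huv).lt_or_gt with h2 | h2
    · exact ⟨1, .inr (key (by decide) (by decide) (by decide) h0 h2)⟩
    · exact ⟨0, .inl (key (by decide) (by decide) (by decide) h1 h2)⟩
  · rcases (hgen 2 u v huv).lt_or_gt with h2 | h2
    · exact ⟨0, .inr (key (by decide) (by decide) (by decide) h1 h2)⟩
    · exact ⟨1, .inl (key (by decide) (by decide) (by decide) h0 h2)⟩
  · exact ⟨2, .inl (key (by decide) (by decide) (by decide) h0 h1)⟩

/-- The level line of `y` cuts an equilateral triangle with apex `x` off the cone at `x`. It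
contains `z`, and from a point `y` of the side opposite `x` no point of the triangle is farther than
`x`. -/
theorem dist_le_dist_of_mem_greedyRegion (hA : A.Equilateral)
    (hpos : ∀ v, pos v ∈ convexHull ℝ (Set.range A.points)) {k : Fin 3} {x y z : V}
    (hy : y ∈ greedyRegion A pos k x) (hz : z ∈ greedyRegion A pos k x)
    (hzy : heightCoord A k (pos z) ≤ heightCoord A k (pos y)) :
    dist (pos z) (pos y) ≤ dist (pos x) (pos y) := by
  obtain ⟨i, j, hij, hik, hjk⟩ := exists_ne_ne k
  obtain ⟨-, hyi, hyj⟩ := (mem_greedyRegion_iff hij hik hjk).1 hy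
  obtain ⟨-, hzi, hzj⟩ := (mem_greedyRegion_iff hij hik hjk).1 hz
  unfold ltCoord at *
  have hsy := heightCoord_add_add hA hij hik hjk (hpos y)
  have hsz := heightCoord_add_add hA hij hik hjk (hpos z)
  refine abs_le_of_sq_le_sq' ?_ dist_nonneg |>.2
  rw [dist_sq_eq hA hij (hpos z) (hpos y), dist_sq_eq hA hij (hpos x) (hpos y)]
  have key : ∀ a b p q : ℝ, 0 < a → 0 < b → p < a → q < b → 0 ≤ p + q →
      p ^ 2 + p * q + q ^ 2 ≤ a ^ 2 + a * b + b ^ 2 := by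
    intro a b p q ha hb hp hq hpq
    rcases le_or_gt 0 p with hp0 | hp0 <;> rcases le_or_gt 0 q with hq0 | hq0
    · gcongr
    · nlinarith [mul_pos ha hb]
    · nlinarith [mul_pos ha hb]
    · linarith
  have := key (heightCoord A i (pos x) - heightCoord A i (pos y))
    (heightCoord A j (pos x) - heightCoord A j (pos y))
    (heightCoord A i (pos z) - heightCoord A i (pos y))
    (heightCoord A j (pos z) - heightCoord A j (pos y)) (by linarith) (by linarith) (by linarith)
    (by linarith) (by linarith)
  linarith

theorem exists_isMinCoord [Finite V] (k : Fin 3) {S : Set V} (hS : S.Nonempty) :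
    ∃ y, IsMinCoord A pos k S y := by
  obtain ⟨y, hy, hmin⟩ := S.exists_min_image (fun v => heightCoord A k (pos v)) S.toFinite hS
  exact ⟨y, hy, fun z hz => not_lt.2 (hmin z hz)⟩

/-- `z` is at most as far from `y` as `x` is, hence adjacent to `y`; minimality of `y` among the
neighbours of `x` puts `z` out of range of `x`. -/
theorem mem_betterCandidates (hA : A.Equilateral)
    (hpos : ∀ v, pos v ∈ convexHull ℝ (Set.range A.points)) {k : Fin 3} {x y z : V}
    (hy : IsMinCoord A pos k {w ∈ greedyRegion A pos k x | (unitDiskGraph r pos).Adj x w} y)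
    (hz : z ∈ greedyRegion A pos k x) (hzy : ltCoord A pos k z y) :
    z ∈ betterCandidates A r pos k x y := by
  refine ⟨hz, hzy, ⟨?_, ?_⟩, ?_⟩
  · rintro rfl
    exact lt_irrefl _ hzy
  · rw [dist_comm]
    exact (dist_le_dist_of_mem_greedyRegion hA hpos hy.1.1 hz (le_of_lt hzy)).trans hy.1.2.2
  · by_contra! h
    exact hy.2 z ⟨hz, ne_of_mem_greedyRegion hz, h⟩ hzy

/-- The link of `x` in a region is the lowest node of the whole region. -/
theorem IsLink.isMinCoord (hA : A.Equilateral)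
    (hpos : ∀ v, pos v ∈ convexHull ℝ (Set.range A.points)) {k : Fin 3} {x z : V}
    (h : IsLink A r pos k x z) : IsMinCoord A pos k (greedyRegion A pos k x) z := by
  obtain ⟨y, hy, hyz, hz⟩ := h
  rcases hyz.cases_head with rfl | ⟨u, hu, huz⟩
  · refine ⟨hy.1.1, fun w hw hwy => ?_⟩
    exact Set.notMem_empty w (hz ▸ mem_betterCandidates hA hpos hy hw hwy)
  · have hu' : IsMinCoord A pos k (greedyRegion A pos k x) u := by
      refine ⟨hu.1.1, fun w hw hwu => ?_⟩
      exact hu.2 w (mem_betterCandidates hA hpos hy hw (lt_trans hwu hu.1.2.1)) hwu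
    -- The first replacement already reaches the minimum of the region, so no second one can occur.
    rcases huz.cases_head with rfl | ⟨t, ht, -⟩
    · exact hu'
    · exact absurd ht.1.2.1 (hu'.2 t ht.1.1)

theorem IsMinCoord.isLink [Finite V] (hA : A.Equilateral)
    (hpos : ∀ v, pos v ∈ convexHull ℝ (Set.range A.points))
    (hgen : ∀ (k : Fin 3) (u v : V), u ≠ v → heightCoord A k (pos u) ≠ heightCoord A k (pos v))
    {k : Fin 3} {x w z : V} (hw : w ∈ greedyRegion A pos k x) (hxw : (unitDiskGraph r pos).Adj x w)
    (h : IsMinCoord A pos k (greedyRegion A pos k x) z) : IsLink A r pos k x z := by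
  obtain ⟨y, hy⟩ := exists_isMinCoord (A := A) (pos := pos) k
    (S := {w ∈ greedyRegion A pos k x | (unitDiskGraph r pos).Adj x w}) ⟨w, hw, hxw⟩
  have hz : betterCandidates A r pos k x z = ∅ :=
    Set.eq_empty_of_forall_notMem fun t ht => h.2 t ht.1 ht.2.1
  refine ⟨y, hy, ?_, hz⟩
  rcases eq_or_ne z y with rfl | hne
  · exact .refl
  · refine .single ⟨mem_betterCandidates hA hpos hy h.1 ?_, fun t ht => h.2 t ht.1⟩
    exact (hgen k z y hne).lt_of_le (not_lt.1 (h.2 y hy.1.1))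

end Links

/-! ### Planarity -/

section Planarity

variable {V : Type*} {A : Affine.Triangle ℝ Plane} {r : ℝ} {pos : V → Plane}

/-- If `w` lies below `u` in both coordinates other than `k`, it is in the region and minimality of
`v` gives `l = k`. Otherwise `w` exceeds `u`, and so also the lower `v`, in one of those two. -/
theorem IsMinCoord.exists_ltCoord (hA : A.Equilateral)
    (hpos : ∀ v, pos v ∈ convexHull ℝ (Set.range A.points))
    (hgen : ∀ (k : Fin 3) (u v : V), u ≠ v → heightCoord A k (pos u) ≠ heightCoord A k (pos v))
    {k : Fin 3} {u v w : V} (h : IsMinCoord A pos k (greedyRegion A pos k u) v) (hwu : w ≠ u)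
    (hwv : w ≠ v) : ∃ l, ltCoord A pos l u w ∧ ltCoord A pos l v w := by
  obtain ⟨i, j, hij, hik, hjk⟩ := exists_ne_ne k
  obtain ⟨huv, hi, hj⟩ := (mem_greedyRegion_iff hij hik hjk).1 h.1
  rcases (hgen i w u hwu).lt_or_gt with h1 | h1
  · rcases (hgen j w u hwu).lt_or_gt with h2 | h2
    · have := h.2 w (mem_greedyRegion_of_lt hA hpos hij hik hjk h1 h2)
      have hvw : ltCoord A pos k v w := (hgen k v w hwv.symm).lt_of_le (not_lt.1 this)
      exact ⟨k, lt_trans huv hvw, hvw⟩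
    · exact ⟨j, h2, lt_trans hj h2⟩
  · exact ⟨i, h1, lt_trans hi h1⟩

/-- Schnyder's condition: every other node exceeds both end points of an edge in some
coordinate. -/
theorem exists_ltCoord_of_adj (hA : A.Equilateral)
    (hpos : ∀ v, pos v ∈ convexHull ℝ (Set.range A.points))
    (hgen : ∀ (k : Fin 3) (u v : V), u ≠ v → heightCoord A k (pos u) ≠ heightCoord A k (pos v))
    {u v w : V} (h : (virtualGraph A r pos).Adj u v) (hwu : w ≠ u) (hwv : w ≠ v) :
    ∃ l, ltCoord A pos l u w ∧ ltCoord A pos l v w := by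
  rw [virtualGraph, SimpleGraph.fromRel_adj] at h
  obtain ⟨-, ⟨k, hk⟩ | ⟨k, hk⟩⟩ := h
  · exact (hk.isMinCoord hA hpos).exists_ltCoord hA hpos hgen hwu hwv
  · obtain ⟨l, h1, h2⟩ := (hk.isMinCoord hA hpos).exists_ltCoord hA hpos hgen hwv hwu
    exact ⟨l, h2, h1⟩

theorem isSimpleArc_segment {a b : Plane} (h : a ≠ b) : IsSimpleArc a b (segment ℝ a b) := by
  refine ⟨⟨⟨fun t => AffineMap.lineMap a b (t : ℝ), by fun_prop⟩, by simp, by simp⟩, ?_, ?_⟩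
  · intro s t hst
    exact Subtype.ext (AffineMap.lineMap_injective ℝ h hst)
  · rw [segment_eq_image_lineMap]
    ext p
    constructor
    · rintro ⟨t, rfl⟩
      exact ⟨t, t.2, rfl⟩
    · rintro ⟨t, ht, rfl⟩
      exact ⟨⟨t, ht⟩, rfl⟩

theorem heightCoord_le_max_of_mem_segment (hA : A.Equilateral)
    (hpos : ∀ v, pos v ∈ convexHull ℝ (Set.range A.points)) (k : Fin 3) {u v : V} {p : Plane}
    (hp : p ∈ segment ℝ (pos u) (pos v)) :
    heightCoord A k p ≤ max (heightCoord A k (pos u)) (heightCoord A k (pos v)) ∧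
      min (heightCoord A k (pos u)) (heightCoord A k (pos v)) ≤ heightCoord A k p := by
  obtain ⟨s, t, hs, ht, hst, rfl⟩ := hp
  rw [heightCoord_convex_combination hA k (hpos u) (hpos v) hs ht hst]
  obtain rfl : s = 1 - t := by linarith
  refine ⟨?_, ?_⟩
  · nlinarith [le_max_left (heightCoord A k (pos u)) (heightCoord A k (pos v)),
      le_max_right (heightCoord A k (pos u)) (heightCoord A k (pos v))]
  · nlinarith [min_le_left (heightCoord A k (pos u)) (heightCoord A k (pos v)),
      min_le_right (heightCoord A k (pos u)) (heightCoord A k (pos v))]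

theorem disjoint_segment_of_ltCoord (hA : A.Equilateral)
    (hpos : ∀ v, pos v ∈ convexHull ℝ (Set.range A.points)) {k : Fin 3} {a b c d : V}
    (hac : ltCoord A pos k a c) (had : ltCoord A pos k a d) (hbc : ltCoord A pos k b c)
    (hbd : ltCoord A pos k b d) :
    Disjoint (segment ℝ (pos a) (pos b)) (segment ℝ (pos c) (pos d)) := by
  refine Set.disjoint_left.2 fun p hp hq => ?_
  have h1 := (heightCoord_le_max_of_mem_segment hA hpos k hp).1
  have h2 := (heightCoord_le_max_of_mem_segment hA hpos k hq).2
  exact absurd (h2.trans h1) (not_le.2 (max_lt (lt_min hac had) (lt_min hbc hbd)))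

theorem disjoint_segment_of_adj (hA : A.Equilateral)
    (hpos : ∀ v, pos v ∈ convexHull ℝ (Set.range A.points))
    (hgen : ∀ (k : Fin 3) (u v : V), u ≠ v → heightCoord A k (pos u) ≠ heightCoord A k (pos v))
    {a b c d : V} (hab : (virtualGraph A r pos).Adj a b) (hcd : (virtualGraph A r pos).Adj c d)
    (hac : a ≠ c) (had : a ≠ d) (hbc : b ≠ c) (hbd : b ≠ d) :
    Disjoint (segment ℝ (pos a) (pos b)) (segment ℝ (pos c) (pos d)) := by
  obtain ⟨i, hi, hi'⟩ := exists_ltCoord_of_adj hA hpos hgen hcd hac had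
  obtain ⟨j, hj, hj'⟩ := exists_ltCoord_of_adj hA hpos hgen hcd hbc hbd
  obtain ⟨k, hk, hk'⟩ := exists_ltCoord_of_adj hA hpos hgen hab hac.symm hbc.symm
  obtain ⟨l, hl, hl'⟩ := exists_ltCoord_of_adj hA hpos hgen hab had.symm hbd.symm
  have hik : i ≠ k := by rintro rfl; exact lt_asymm hi hk
  have hil : i ≠ l := by rintro rfl; exact lt_asymm hi' hl
  have hjk : j ≠ k := by rintro rfl; exact lt_asymm hj hk'
  have hjl : j ≠ l := by rintro rfl; exact lt_asymm hj' hl'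
  -- `{i, j}` and `{k, l}` are disjoint subsets of a three-element set, so one of them is a
  -- singleton; that coordinate separates the edges.
  have : i = j ∨ k = l := by
    clear * - hik hil hjk hjl
    revert i j k l; decide
  rcases this with rfl | rfl
  · exact (disjoint_segment_of_ltCoord hA hpos hi hj hi' hj').symm
  · exact disjoint_segment_of_ltCoord hA hpos hk hl hk' hl'

theorem segment_inter_segment_of_adj (hA : A.Equilateral)
    (hpos : ∀ v, pos v ∈ convexHull ℝ (Set.range A.points))
    (hgen : ∀ (k : Fin 3) (u v : V), u ≠ v → heightCoord A k (pos u) ≠ heightCoord A k (pos v))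
    {a b c : V} (hab : (virtualGraph A r pos).Adj a b) (hac : (virtualGraph A r pos).Adj a c)
    (hbc : b ≠ c) : segment ℝ (pos a) (pos b) ∩ segment ℝ (pos a) (pos c) ⊆ {pos a} := by
  obtain ⟨i, hi, hi'⟩ := exists_ltCoord_of_adj hA hpos hgen hac hab.ne' hbc
  obtain ⟨k, hk, hk'⟩ := exists_ltCoord_of_adj hA hpos hgen hab hac.ne' hbc.symm
  rintro _ ⟨⟨s, t, hs, ht, hst, rfl⟩, ⟨s', t', hs', ht', hst', h⟩⟩
  have key : ∀ l, s' * heightCoord A l (pos a) + t' * heightCoord A l (pos c) =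
      s * heightCoord A l (pos a) + t * heightCoord A l (pos b) := fun l => by
    rw [← heightCoord_convex_combination hA l (hpos a) (hpos b) hs ht hst,
      ← heightCoord_convex_combination hA l (hpos a) (hpos c) hs' ht' hst', h]
  have h1 := key i
  have h2 := key k
  unfold ltCoord at *
  obtain rfl : s = 1 - t := by linarith
  obtain rfl : s' = 1 - t' := by linarith
  obtain rfl | ht0 := ht.eq_or_lt
  · simp
  exfalso
  -- At a common point at fractions `t` of `ab` and `t'` of `ac`, coordinate `i`, where `b` is above
  -- `a` and `c`, forces `t < t'`; coordinate `k`, where `c` is above `a` and `b`, forces `t' < t`.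
  have aux : ∀ p q t t' : ℝ, 0 < t → 0 ≤ t' → 0 < p → q < p → t' * q = t * p → t < t' := by
    intro p q t t' ht ht' hp hqp h
    by_contra! hle
    rcases le_or_gt q 0 with hq | hq
    · nlinarith [mul_pos ht hp, mul_nonneg ht' (neg_nonneg.2 hq)]
    · nlinarith [mul_le_mul_of_nonneg_right hle hq.le, mul_lt_mul_of_pos_left hqp ht]
  have l1 := aux (heightCoord A i (pos b) - heightCoord A i (pos a))
    (heightCoord A i (pos c) - heightCoord A i (pos a)) t t' ht0 ht' (by linarith) (by linarith)
    (by linarith)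
  have l2 := aux (heightCoord A k (pos c) - heightCoord A k (pos a))
    (heightCoord A k (pos b) - heightCoord A k (pos a)) t' t (ht0.trans l1) ht (by linarith)
    (by linarith) (by linarith)
  exact lt_asymm l1 l2

theorem isPlaneEmbedding_virtualGraph (hA : A.Equilateral)
    (hpos : ∀ v, pos v ∈ convexHull ℝ (Set.range A.points))
    (hgen : ∀ (k : Fin 3) (u v : V), u ≠ v →
      heightCoord A k (pos u) ≠ heightCoord A k (pos v)) :
    IsPlaneEmbedding (virtualGraph A r pos) pos (straightEdge pos) := by
  have hinj : Function.Injective pos := by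
    intro u v huv
    by_contra hne
    exact hgen 0 u v hne (by rw [huv])
  refine ⟨hinj, fun u v huv => isSimpleArc_segment (hinj.ne huv.ne), ?_, ?_⟩
  · intro e
    induction e with | _ u v =>
    intro he w hw
    by_contra hne
    rw [Sym2.mem_iff, not_or] at hne
    obtain ⟨l, h1, h2⟩ := exists_ltCoord_of_adj hA hpos hgen he hne.1 hne.2
    exact absurd (heightCoord_le_max_of_mem_segment hA hpos l hw).1 (not_le.2 (max_lt h1 h2))
  · intro e he f hf hef
    induction e with | _ a b =>
    induction f with | _ c d =>
    rw [SimpleGraph.mem_edgeSet] at he hf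
    change segment ℝ (pos a) (pos b) ∩ segment ℝ (pos c) (pos d) ⊆ _
    intro p hp
    rcases eq_or_ne a c with rfl | hac
    · have hbd : b ≠ d := by rintro rfl; exact hef rfl
      exact ⟨a, by simp, (segment_inter_segment_of_adj hA hpos hgen he hf hbd hp).symm⟩
    rcases eq_or_ne a d with rfl | had
    · have hbc : b ≠ c := by rintro rfl; exact hef Sym2.eq_swap
      rw [segment_symm ℝ (pos c)] at hp
      exact ⟨a, by simp, (segment_inter_segment_of_adj hA hpos hgen he hf.symm hbc hp).symm⟩
    rcases eq_or_ne b c with rfl | hbc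
    · rw [segment_symm ℝ (pos a)] at hp
      exact ⟨b, by simp, (segment_inter_segment_of_adj hA hpos hgen he.symm hf had hp).symm⟩
    rcases eq_or_ne b d with rfl | hbd
    · rw [segment_symm ℝ (pos a), segment_symm ℝ (pos c)] at hp
      exact ⟨b, by simp, (segment_inter_segment_of_adj hA hpos hgen he.symm hf.symm hac hp).symm⟩
    · exact absurd hp (Set.disjoint_iff_inter_eq_empty.1
        (disjoint_segment_of_adj hA hpos hgen he hf hac had hbc hbd) ▸ Set.notMem_empty p)

end Planarity

/-! ### Lengths of walks -/

section Spanner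

variable {V : Type*}

theorem euclideanLength_nil {G : SimpleGraph V} (pos : V → Plane) (x : V) :
    euclideanLength pos (SimpleGraph.Walk.nil : G.Walk x x) = 0 := by
  simp [euclideanLength]

theorem euclideanLength_cons {G : SimpleGraph V} (pos : V → Plane) {x y z : V} (h : G.Adj x y)
    (p : G.Walk y z) :
    euclideanLength pos (.cons h p) = dist (pos x) (pos y) + euclideanLength pos p := by
  simp [euclideanLength]

theorem euclideanLength_append {G : SimpleGraph V} (pos : V → Plane) {x y z : V}
    (p : G.Walk x y) (q : G.Walk y z) :
    euclideanLength pos (p.append q) = euclideanLength pos p + euclideanLength pos q := by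
  simp [euclideanLength]

theorem euclideanLength_reverse {G : SimpleGraph V} (pos : V → Plane) {x y : V}
    (p : G.Walk x y) : euclideanLength pos p.reverse = euclideanLength pos p := by
  simp [euclideanLength, Function.comp_def, dist_comm]

theorem euclideanLength_bypass_le [DecidableEq V] {G : SimpleGraph V} (pos : V → Plane) {x y : V}
    (p : G.Walk x y) : euclideanLength pos p.bypass ≤ euclideanLength pos p := by
  refine (p.darts_bypass_sublist_darts.map _).sum_le_sum fun a ha => ?_
  obtain ⟨d, -, rfl⟩ := List.mem_map.1 ha
  exact dist_nonneg

/-! ### The spanning ratio -/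

variable {A : Affine.Triangle ℝ Plane} {r : ℝ} {pos : V → Plane}

/-- The segment makes an angle of at most 30° with the axis of the cone, and `2 / √3 = 1 / cos 30°`.
-/
theorem dist_le_of_mem_greedyRegion (hA : A.Equilateral)
    (hpos : ∀ v, pos v ∈ convexHull ℝ (Set.range A.points)) {k : Fin 3} {x z : V}
    (hz : z ∈ greedyRegion A pos k x) :
    dist (pos x) (pos z) ≤ 2 / √3 * (heightCoord A k (pos z) - heightCoord A k (pos x)) := by
  obtain ⟨i, j, hij, hik, hjk⟩ := exists_ne_ne k
  obtain ⟨hk, hi, hj⟩ := (mem_greedyRegion_iff hij hik hjk).1 hz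
  unfold ltCoord at *
  have hx := heightCoord_add_add hA hij hik hjk (hpos x)
  have hz := heightCoord_add_add hA hij hik hjk (hpos z)
  have hs : √3 ^ 2 = 3 := Real.sq_sqrt (by norm_num)
  refine abs_le_of_sq_le_sq' ?_ (mul_nonneg (by positivity) (by linarith)) |>.2
  rw [dist_sq_eq hA hij (hpos x) (hpos z), mul_pow, div_pow, hs]
  have : heightCoord A k (pos z) - heightCoord A k (pos x) =
    (heightCoord A i (pos x) - heightCoord A i (pos z)) +
      (heightCoord A j (pos x) - heightCoord A j (pos z)) := by linarith
  rw [this]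
  nlinarith [mul_pos (sub_pos.2 hi) (sub_pos.2 hj)]

/-- The squares of the two sides differ by `4 * (x_j - y_j) ^ 2`. -/
theorem le_two_mul_dist (hA : A.Equilateral)
    (hpos : ∀ v, pos v ∈ convexHull ℝ (Set.range A.points)) {i j k : Fin 3} (hij : i ≠ j)
    (hik : i ≠ k) (hjk : j ≠ k) {x y : V} :
    2 / √3 * (heightCoord A k (pos y) - heightCoord A k (pos x) +
      (heightCoord A i (pos x) - heightCoord A i (pos y))) ≤ 2 * dist (pos x) (pos y) := by
  have hx := heightCoord_add_add hA hij hik hjk (hpos x)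
  have hz := heightCoord_add_add hA hij hik hjk (hpos y)
  have hs : √3 ^ 2 = 3 := Real.sq_sqrt (by norm_num)
  refine abs_le_of_sq_le_sq' ?_ (by positivity) |>.2
  rw [mul_pow 2 (dist _ _), dist_sq_eq hA hij (hpos x) (hpos y), mul_pow, div_pow, hs]
  have : heightCoord A k (pos y) - heightCoord A k (pos x) =
    (heightCoord A i (pos x) - heightCoord A i (pos y)) +
      (heightCoord A j (pos x) - heightCoord A j (pos y)) := by linarith
  rw [this]
  nlinarith [sq_nonneg (heightCoord A j (pos x) - heightCoord A j (pos y))]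

/-- The nodes of the triangle spanned by `x` and a node `y` of its `k`-th greedy region that lie in
the `i`-th greedy region of `y`. -/
def cornerRegion (A : Affine.Triangle ℝ Plane) (pos : V → Plane) (i : Fin 3) (x y : V) : Set V :=
  {w | w ∈ greedyRegion A pos i y ∧ ltCoord A pos i w x}

/-- Nodes `x` and `y` are joined by a walk of length at most `2 / √3 * b`. -/
def HasWalkOfLengthLE (A : Affine.Triangle ℝ Plane) (r : ℝ) (pos : V → Plane) (b : ℝ) (x y : V) :
    Prop :=
  ∃ q : (virtualGraph A r pos).Walk x y, euclideanLength pos q ≤ 2 / √3 * b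

theorem HasWalkOfLengthLE.mono {b c : ℝ} {x y : V} (h : HasWalkOfLengthLE A r pos b x y)
    (hbc : b ≤ c) : HasWalkOfLengthLE A r pos c x y := by
  obtain ⟨q, hq⟩ := h
  exact ⟨q, hq.trans (by gcongr)⟩

theorem HasWalkOfLengthLE.symm {b : ℝ} {x y : V} (h : HasWalkOfLengthLE A r pos b x y) :
    HasWalkOfLengthLE A r pos b y x := by
  obtain ⟨q, hq⟩ := h
  exact ⟨q.reverse, by rwa [euclideanLength_reverse]⟩

theorem HasWalkOfLengthLE.trans {b c : ℝ} {x y z : V} (h : HasWalkOfLengthLE A r pos b x y)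
    (h' : HasWalkOfLengthLE A r pos c y z) : HasWalkOfLengthLE A r pos (b + c) x z := by
  obtain ⟨q, hq⟩ := h
  obtain ⟨q', hq'⟩ := h'
  exact ⟨q.append q', by rw [euclideanLength_append, mul_add]; exact add_le_add hq hq'⟩

theorem IsLink.hasWalkOfLengthLE (hA : A.Equilateral)
    (hpos : ∀ v, pos v ∈ convexHull ℝ (Set.range A.points)) {k : Fin 3} {x z : V}
    (h : IsLink A r pos k x z) :
    HasWalkOfLengthLE A r pos (heightCoord A k (pos z) - heightCoord A k (pos x)) x z := by
  have hz := (h.isMinCoord hA hpos).1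
  have hadj : (virtualGraph A r pos).Adj x z := by
    rw [virtualGraph, SimpleGraph.fromRel_adj]
    exact ⟨ne_of_mem_greedyRegion hz, .inl ⟨k, h⟩⟩
  refine ⟨.cons hadj .nil, ?_⟩
  rw [euclideanLength_cons, euclideanLength_nil, add_zero]
  exact dist_le_of_mem_greedyRegion hA hpos hz

/-- For `y` in the `k`-th greedy region of `x`: a walk round a corner of their triangle, where the
longer of the two sides need be taken into account only if the corner region is non-empty. -/
def SpanningBound (A : Affine.Triangle ℝ Plane) (r : ℝ) (pos : V → Plane) (k : Fin 3) (x y : V) :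
    Prop :=
  ∀ i j, i ≠ j → i ≠ k → j ≠ k → ∀ b,
    heightCoord A j (pos x) - heightCoord A j (pos y) ≤ b →
    ((cornerRegion A pos i x y).Nonempty →
      heightCoord A i (pos x) - heightCoord A i (pos y) ≤ b) →
    HasWalkOfLengthLE A r pos (heightCoord A k (pos y) - heightCoord A k (pos x) + b) x y

/-- The inductive step when the link `z` of `x` lies in a corner of the triangle of `x`, `y`. -/
theorem hasWalkOfLengthLE_of_spanningBound (hA : A.Equilateral)
    (hpos : ∀ v, pos v ∈ convexHull ℝ (Set.range A.points)) {i j k : Fin 3} (hij : i ≠ j)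
    (hik : i ≠ k) (hjk : j ≠ k) {x y z : V} (hy : y ∈ greedyRegion A pos k x)
    (hlink : IsLink A r pos k x z) (hb : SpanningBound A r pos i y z) :
    HasWalkOfLengthLE A r pos (heightCoord A k (pos y) - heightCoord A k (pos x) +
      (heightCoord A i (pos x) - heightCoord A i (pos y))) x y := by
  have hz := hlink.isMinCoord hA hpos
  obtain ⟨hyk, hyi, hyj⟩ := (mem_greedyRegion_iff hij hik hjk).1 hy
  obtain ⟨hzk, hzi, hzj⟩ := (mem_greedyRegion_iff hij hik hjk).1 hz.1
  have h := hb j k hjk hij.symm hik.symm _ le_rfl ?_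
  · refine ((hlink.hasWalkOfLengthLE hA hpos).trans h.symm).mono ?_
    unfold ltCoord at *
    linarith
  -- The relevant corner region of `y` and `z` is empty: a node in it would lie in the region of
  -- `x`, below the lowest node `z`.
  · rintro ⟨w, hw, hwy⟩
    obtain ⟨-, hwi, hwk⟩ := (mem_greedyRegion_iff hik hij hjk.symm).1 hw
    exact absurd hwk (hz.2 w (mem_greedyRegion_of_lt hA hpos hij hik hjk (lt_trans hwi hzi)
      (lt_trans hwy hyj)))

theorem spanningBound_of_adj [Finite V] (hA : A.Equilateral)
    (hpos : ∀ v, pos v ∈ convexHull ℝ (Set.range A.points))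
    (hgen : ∀ (k : Fin 3) (u v : V), u ≠ v → heightCoord A k (pos u) ≠ heightCoord A k (pos v))
    (k : Fin 3) (x y : V) (hy : y ∈ greedyRegion A pos k x)
    (hxy : (unitDiskGraph r pos).Adj x y) : SpanningBound A r pos k x y := by
  -- The induction is on the height of the triangle; real values are well-founded here because there
  -- are finitely many triples.
  let f : Fin 3 × V × V → ℝ :=
    fun p => heightCoord A p.1 (pos p.2.2) - heightCoord A p.1 (pos p.2.1)
  have hwf : WellFounded (InvImage (· < ·) f) :=
    haveI : IsTrans _ (InvImage (· < ·) f) := ⟨fun _ _ _ h h' => lt_trans (α := ℝ) h h'⟩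
    haveI : Std.Irrefl (InvImage (· < ·) f) := ⟨fun _ h => lt_irrefl (α := ℝ) _ h⟩
    Finite.wellFounded_of_trans_of_irrefl _
  suffices H : ∀ p : Fin 3 × V × V, p.2.2 ∈ greedyRegion A pos p.1 p.2.1 →
      (unitDiskGraph r pos).Adj p.2.1 p.2.2 → SpanningBound A r pos p.1 p.2.1 p.2.2 from
    H (k, x, y) hy hxy
  intro p
  induction p using hwf.induction with | _ p ih
  obtain ⟨k, x, y⟩ := p
  intro hy hxy i j hij hik hjk b hbj hbi
  dsimp only at *
  replace ih : ∀ l u v, v ∈ greedyRegion A pos l u → (unitDiskGraph r pos).Adj u v →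
      heightCoord A l (pos v) - heightCoord A l (pos u) <
        heightCoord A k (pos y) - heightCoord A k (pos x) → SpanningBound A r pos l u v :=
    fun l u v h h' hlt => ih (l, u, v) hlt h h'
  obtain ⟨z, hz⟩ := exists_isMinCoord (A := A) (pos := pos) k ⟨y, hy⟩
  have hlink := hz.isLink hA hpos hgen hy hxy
  obtain ⟨hyk, hyi, hyj⟩ := (mem_greedyRegion_iff hij hik hjk).1 hy
  obtain ⟨hzk, hzi, hzj⟩ := (mem_greedyRegion_iff hij hik hjk).1 hz.1
  have hsx := heightCoord_add_add hA hij hik hjk (hpos x)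
  have hsy := heightCoord_add_add hA hij hik hjk (hpos y)
  have hsz := heightCoord_add_add hA hij hik hjk (hpos z)
  have hle := not_lt.1 (hz.2 y hy)
  rcases eq_or_ne z y with rfl | hne
  · refine (hlink.hasWalkOfLengthLE hA hpos).mono ?_
    unfold ltCoord at *
    linarith
  have hadj : (unitDiskGraph r pos).Adj z y :=
    ⟨hne, (dist_le_dist_of_mem_greedyRegion hA hpos hy hz.1 hle).trans hxy.2⟩
  have hkzy : ltCoord A pos k z y := (hgen k z y hne).lt_of_le hle
  unfold ltCoord at hyk hyi hyj hzk hzi hzj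
  rcases (hgen i z y hne).lt_or_gt with hi | hi <;>
    rcases (hgen j z y hne).lt_or_gt with hj | hj
  -- `z` cannot be below `y` in all three coordinates, since their sum is constant.
  · linarith
  -- `z` lies in the corner on the `j` side, whose cost is always covered by `b`.
  · have hzy := mem_greedyRegion_of_lt hA hpos hik hij hjk.symm hi hkzy
    refine (hasWalkOfLengthLE_of_spanningBound hA hpos hij.symm hjk hik hy hlink
      (ih j y z hzy hadj.symm (by linarith))).mono (by linarith)
  -- `z` itself witnesses that the `i`-th corner region is non-empty, so `b` covers the side `i`
  -- too.
  · have hzy := mem_greedyRegion_of_lt hA hpos hjk hij.symm hik.symm hj hkzy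
    have := hbi ⟨z, hzy, hzi⟩
    refine (hasWalkOfLengthLE_of_spanningBound hA hpos hij hik hjk hy hlink
      (ih i y z hzy hadj.symm (by linarith))).mono (by linarith)
  -- `y` is in the `k`-th region of `z`: the height splits at `z`, and the corner of the smaller
  -- triangle lies in that of the larger, so the same `b` serves.
  · have hyz := mem_greedyRegion_of_lt hA hpos hij hik hjk hi hj
    refine ((hlink.hasWalkOfLengthLE hA hpos).trans
      (ih k z y hyz hadj (by linarith) i j hij hik hjk b (by linarith) ?_)).mono (by linarith)
    rintro ⟨w, hw, hwz⟩
    have := hbi ⟨w, hw, lt_trans hwz hzi⟩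
    linarith

theorem exists_walk_of_adj [Finite V] (hA : A.Equilateral)
    (hpos : ∀ v, pos v ∈ convexHull ℝ (Set.range A.points))
    (hgen : ∀ (k : Fin 3) (u v : V), u ≠ v → heightCoord A k (pos u) ≠ heightCoord A k (pos v))
    {x y : V} (hxy : (unitDiskGraph r pos).Adj x y) :
    ∃ q : (virtualGraph A r pos).Walk x y,
      euclideanLength pos q ≤ 2 * dist (pos x) (pos y) := by
  have key : ∀ {k : Fin 3} {u v : V}, v ∈ greedyRegion A pos k u → (unitDiskGraph r pos).Adj u v →
      ∃ q : (virtualGraph A r pos).Walk u v,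
        euclideanLength pos q ≤ 2 * dist (pos u) (pos v) := by
    intro k u v hv huv
    obtain ⟨i, j, hij, hik, hjk⟩ := exists_ne_ne k
    have h := spanningBound_of_adj hA hpos hgen k u v hv huv i j hij hik hjk
    rcases le_total (heightCoord A i (pos u) - heightCoord A i (pos v))
      (heightCoord A j (pos u) - heightCoord A j (pos v)) with hle | hle
    · obtain ⟨q, hq⟩ := h _ le_rfl fun _ => hle
      exact ⟨q, hq.trans (le_two_mul_dist hA hpos hij.symm hjk hik)⟩
    · obtain ⟨q, hq⟩ := h _ hle fun _ => le_rfl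
      exact ⟨q, hq.trans (le_two_mul_dist hA hpos hij hik hjk)⟩
  obtain ⟨k, hk | hk⟩ := mem_greedyRegion_or_mem_greedyRegion hA hpos hgen hxy.ne
  · exact key hk hxy
  · obtain ⟨q, hq⟩ := key hk hxy.symm
    exact ⟨q.reverse, by rwa [euclideanLength_reverse, dist_comm]⟩

theorem exists_walk_le_two_mul [Finite V] (hA : A.Equilateral)
    (hpos : ∀ v, pos v ∈ convexHull ℝ (Set.range A.points))
    (hgen : ∀ (k : Fin 3) (u v : V), u ≠ v → heightCoord A k (pos u) ≠ heightCoord A k (pos v))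
    {x y : V} (p : (unitDiskGraph r pos).Walk x y) :
    ∃ q : (virtualGraph A r pos).Walk x y, euclideanLength pos q ≤ 2 * euclideanLength pos p := by
  induction p with
  | nil => exact ⟨.nil, by simp [euclideanLength_nil]⟩
  | cons h p ih =>
    obtain ⟨q, hq⟩ := ih
    obtain ⟨q', hq'⟩ := exists_walk_of_adj hA hpos hgen h
    exact ⟨q'.append q, by rw [euclideanLength_append, euclideanLength_cons]; linarith⟩

end Spanner

theorem mainTheorem1 {V : Type*} [Finite V] (A : Affine.Triangle ℝ Plane) (hA : A.Equilateral)
    (r : ℝ) (hr : 0 < r) (pos : V → Plane)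
    (hpos : ∀ v, pos v ∈ convexHull ℝ (Set.range A.points))
    (hgen : ∀ (k : Fin 3) (u v : V), u ≠ v →
      heightCoord A k (pos u) ≠ heightCoord A k (pos v))
    (hconn : (unitDiskGraph r pos).Connected) :
    IsPlanar (virtualGraph A r pos) ∧
    IsPlaneEmbedding (virtualGraph A r pos) pos (straightEdge pos) ∧
    ∀ (x y : V) (p : (unitDiskGraph r pos).Walk x y), p.IsPath →
      ∃ q : (virtualGraph A r pos).Walk x y, q.IsPath ∧
        euclideanLength pos q ≤ 2 * euclideanLength pos p := by
  have h := isPlaneEmbedding_virtualGraph (r := r) hA hpos hgen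
  refine ⟨⟨pos, straightEdge pos, h⟩, h, fun x y p _ => ?_⟩
  classical
  obtain ⟨q, hq⟩ := exists_walk_le_two_mul hA hpos hgen p
  exact ⟨q.bypass, q.bypass_isPath, (euclideanLength_bypass_le pos q).trans hq⟩
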